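/- Let $n,w$ be integers with $w>3$ and $n>2w$. The Johnson graph $J(n,w)$ has as vertices the binary vectors of length $n$ with exactly $w$ ones, two of them being adjacent if they have exactly $w-1$ common ones. An equitable $2$-partition of a graph with quotient matrix $S=(s_{ij})_{i,j\in\{1,2\}}$ is a partition $(C_1,C_2)$ of its vertex set into two nonempty cells such that every vertex of $C_i$ has exactly $s_{ij}$ neighbours in $C_j$. Put $\lambda_2(n,w)=(w-2)(n-w-2)-2$. Then: (1) $J(n,w)$ has no equitable $2$-partition whose quotient matrix has the eigenvalue $\lambda_2(n,w)$. (2) In particular, for no $b\in\{n-1,n,\dots,2n-1\}$ does $J(n,w)$ have an equitable $2$-partition with quotient matrix $$\begin{pmatrix} w(n-w)-b & b\\ 2n-2-b & w(n-w)-2n+2+b\end{pmatrix}.$$ (3) These are, up to the order of the cells, the only matrices that come into question: every $2\times 2$ matrix $S=(s_{ij})$ of non-negative integers with both row sums equal to $w(n-w)$ (the degree of $J(n,w)$), with $s_{12}\ge s_{21}$ and with the eigenvalue $\lambda_2(n,w)$ is the matrix in (2) for some $b\in\{n-1,n,\dots,2n-1\}$. -/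

import Mathlib

/-- The Johnson graph `J(n, w)`: its vertices are the binary vectors of length `n` with `w` ones,
given by their supports, and two vertices are adjacent if they have exactly `w - 1` common ones. -/
def johnsonGraph (n w : ℕ) : SimpleGraph {s : Finset (Fin n) // s.card = w} where
  Adj s t := (s.1 ∩ t.1).card + 1 = w
  symm := ⟨fun s t h => by rw [Finset.inter_comm]; exact h⟩
  loopless := ⟨fun s h => by
    have hs := s.2
    rw [Finset.inter_self] at h
    omega⟩

/-- The number `λ_i(n, w) = (w - i)(n - w - i) - i`. -/
def johnsonEigenvalue (n w i : ℕ) : ℝ :=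
  ((w : ℝ) - i) * ((n : ℝ) - w - i) - i

/-- The family of cells `C` is an equitable partition of the vertex set of `G` with quotient
matrix `S`: the cells are nonempty, pairwise disjoint, cover the vertex set, and every vertex of
`C i` has exactly `S i j` neighbours in `C j`. -/
structure IsEquitablePartition {V ι : Type*} [Finite V] (G : SimpleGraph V) (C : ι → Set V)
    (S : Matrix ι ι ℤ) : Prop where
  nonempty : ∀ i, (C i).Nonempty
  disjoint : Pairwise fun i j => Disjoint (C i) (C j)
  cover : ⋃ i, C i = Set.univ
  card_neighbors : ∀ i j, ∀ v ∈ C i, ((G.neighborSet v ∩ C j).ncard : ℤ) = S i j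

/-- The real number `μ` is an eigenvalue of the integer matrix `S`. -/
def HasMatrixEigenvalue {ι : Type*} [Fintype ι] [DecidableEq ι] (S : Matrix ι ι ℤ) (μ : ℝ) :
    Prop :=
  Module.End.HasEigenvalue (Matrix.toLin' (S.map (fun z : ℤ => (z : ℝ)))) μ

/-- The matrix `[[w(n-w)-b, b], [2n-2-b, w(n-w)-2n+2+b]]`. -/
def secondQuotientMatrix (n w b : ℤ) : Matrix (Fin 2) (Fin 2) ℤ :=
  !![w * (n - w) - b, b; 2 * n - 2 - b, w * (n - w) - 2 * n + 2 + b]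

/-! The indicator `f` of a cell is, up to an additive constant, an eigenfunction for `λ_2(n, w)`.
The difference `T ↦ f (T ∪ {i}) - f (T ∪ {j})` loses the constant and is an eigenfunction on `J(n-2,
w-1)` for `λ_2(n, w) + 1 = λ_1(n-2, w-1)`. Differencing once more gives the eigenvalue `λ_0(n-4,
w-2)`, the degree, so second differences are constant and first differences are affine in the
coordinates, with mean zero. Since their values lie in `{-1, 0, 1}` and `n > 2w`, each first
difference is zero or of the form `x_k - x_l` (`SwapEigen.exists_coordinate_difference`).

If `k ≠ l` occurs, then on sets meeting `X = {i, j, k, l}` exactly in an edge of the four-cycle `i,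
k, j, l`, the values of `f` are alternately 1 and 0 around the cycle. This forces `f` to depend only
on the intersection with `X`, and comparing `i` with a point outside `X` then produces a value -1 or
2 (`not_isFourCycle`). So all differences vanish and `f` is constant, although both cells are
nonempty.

The statements about explicit matrices follow because, with row sums `w(n-w)`, having the eigenvalue
`λ_2` means `s₁₂ + s₂₁ = 2n - 2`. -/

/-! ### Swap sums, differencing, and the maximum principle -/

section Swaps

variable {α : Type*} [DecidableEq α]

/-- On the `w`-element subsets of `U`, the sum of `f` over all sets obtained by exchanging one
element is `μ * f + c`. -/
def SwapEigen (U : Finset α) (w : ℕ) (μ c : ℤ) (f : Finset α → ℤ) : Prop :=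
  ∀ s ⊆ U, s.card = w →
    ∑ x ∈ s, ∑ y ∈ U \ s, f (insert y (s.erase x)) = μ * f s + c

/-- The swaps are sorted by whether `i` leaves and whether `j` enters. The two middle sums are
symmetric in `i` and `j`, so they cancel in `SwapEigen.sub`. -/
theorem sum_swaps_insert {U T : Finset α} {i j : α} (hij : i ≠ j) (hj : j ∈ U)
    (hT : T ⊆ U \ {i, j}) (f : Finset α → ℤ) :
    ∑ x ∈ insert i T, ∑ y ∈ U \ insert i T, f (insert y ((insert i T).erase x)) =
      f (insert j T) + ∑ y ∈ (U \ {i, j}) \ T, f (insert y T) +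
        ∑ x ∈ T, f (insert j (insert i (T.erase x))) +
        ∑ x ∈ T, ∑ y ∈ (U \ {i, j}) \ T, f (insert i (insert y (T.erase x))) := by
  have hiT : i ∉ T := fun h => by simpa using hT h
  have hjT : j ∉ T := fun h => by simpa using hT h
  have hU : U \ insert i T = insert j ((U \ {i, j}) \ T) := by
    ext a
    simp only [Finset.mem_sdiff, Finset.mem_insert, Finset.mem_singleton]
    constructor
    · rintro ⟨h1, h2⟩
      by_cases h : a = j
      · exact Or.inl h
      · tauto
    · rintro (rfl | h)
      · exact ⟨hj, by tauto⟩
      · tauto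
  have hjW : j ∉ (U \ {i, j}) \ T := by simp
  rw [Finset.sum_insert hiT, hU, Finset.sum_insert hjW, Finset.erase_insert hiT]
  have : ∀ x ∈ T, ∑ y ∈ insert j ((U \ {i, j}) \ T), f (insert y ((insert i T).erase x)) =
      f (insert j (insert i (T.erase x))) +
        ∑ y ∈ (U \ {i, j}) \ T, f (insert i (insert y (T.erase x))) := by
    intro x hx
    have hix : i ≠ x := fun h => hiT (h ▸ hx)
    rw [Finset.sum_insert hjW, Finset.erase_insert_of_ne hix]
    simp only [Finset.insert_comm i]
  rw [Finset.sum_congr rfl this, Finset.sum_add_distrib]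
  ring

/-- The swap of `i` with `j` contributes minus the difference itself, which raises the eigenvalue by
1; the constant `c` cancels. -/
theorem SwapEigen.sub {U : Finset α} {w : ℕ} {μ c : ℤ} {f : Finset α → ℤ}
    (h : SwapEigen U (w + 1) μ c f) {i j : α} (hij : i ≠ j) (hi : i ∈ U) (hj : j ∈ U) :
    SwapEigen (U \ {i, j}) w (μ + 1) 0 (fun T => f (insert i T) - f (insert j T)) := by
  intro T hT hw
  have hiT : i ∉ T := fun h => by simpa using hT h
  have hjT : j ∉ T := fun h => by simpa using hT h
  have hTU : T ⊆ U := hT.trans Finset.sdiff_subset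
  have h1 := h (insert i T) (Finset.insert_subset hi hTU) (by rw [Finset.card_insert_of_notMem hiT, hw])
  have h2 := h (insert j T) (Finset.insert_subset hj hTU) (by rw [Finset.card_insert_of_notMem hjT, hw])
  rw [sum_swaps_insert hij hj hT] at h1
  rw [sum_swaps_insert hij.symm hi (by rwa [Finset.pair_comm])] at h2
  rw [Finset.pair_comm j i] at h2
  simp only [Finset.insert_comm i j] at h2
  simp only [Finset.sum_sub_distrib]
  linarith

/-- A property of `w`-element subsets of `U` that is preserved by exchanging one element holds for
all of them as soon as it holds for one. -/
theorem swap_induction {U : Finset α} {w : ℕ} {P : Finset α → Prop}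
    (hP : ∀ s ⊆ U, s.card = w → ∀ x ∈ s, ∀ y ∈ U \ s, P s → P (insert y (s.erase x)))
    {s t : Finset α} (hs : s ⊆ U) (ht : t ⊆ U) (hsw : s.card = w) (htw : t.card = w) (h : P s) :
    P t := by
  induction hk : (t \ s).card generalizing s with
  | zero =>
    have : t ⊆ s := by rwa [Finset.card_eq_zero, Finset.sdiff_eq_empty_iff_subset] at hk
    rwa [Finset.eq_of_subset_of_card_le this (by omega)]
  | succ k ih =>
    obtain ⟨y, hy⟩ : (t \ s).Nonempty := by rw [← Finset.card_pos]; omega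
    have hst : (s \ t).card = (t \ s).card := Finset.card_sdiff_comm (by omega)
    obtain ⟨x, hx⟩ : (s \ t).Nonempty := by rw [← Finset.card_pos]; omega
    rw [Finset.mem_sdiff] at hx hy
    have hys : y ∉ s.erase x := fun h => hy.2 (Finset.mem_of_mem_erase h)
    refine ih (s := insert y (s.erase x)) ?_ ?_
      (hP s hs hsw x hx.1 y (Finset.mem_sdiff.2 ⟨ht hy.1, hy.2⟩) h) ?_
    · exact Finset.insert_subset (ht hy.1) ((Finset.erase_subset _ _).trans hs)
    · rw [Finset.card_insert_of_notMem hys, Finset.card_erase_add_one hx.1, hsw]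
    · have : t \ insert y (s.erase x) = (t \ s).erase y := by
        ext a
        simp only [Finset.mem_sdiff, Finset.mem_insert, Finset.mem_erase]
        constructor
        · rintro ⟨h1, h2⟩
          refine ⟨by tauto, h1, fun h => h2 (Or.inr ⟨?_, h⟩)⟩
          rintro rfl
          exact hx.2 h1
        · tauto
      rw [this, Finset.card_erase_of_mem (Finset.mem_sdiff.2 hy), hk]
      rfl

/-- An eigenfunction of a Johnson graph for its degree is constant. -/
theorem SwapEigen.const {U : Finset α} {w : ℕ} {f : Finset α → ℤ}
    (h : SwapEigen U w (w * (U.card - w)) 0 f) {s t : Finset α} (hs : s ⊆ U) (ht : t ⊆ U)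
    (hsw : s.card = w) (htw : t.card = w) : f s = f t := by
  obtain ⟨m, hm, hmax⟩ := (Finset.powersetCard w U).exists_max_image f
    ⟨s, Finset.mem_powersetCard.2 ⟨hs, hsw⟩⟩
  rw [Finset.mem_powersetCard] at hm
  have key : ∀ r ⊆ U, r.card = w → f r = f m := by
    intro r hr hrw
    refine swap_induction (P := fun r => f r = f m) ?_ hm.1 hr hm.2 hrw rfl
    intro a ha haw x hx y hy hfa
    have hle : ∀ x ∈ a, ∀ y ∈ U \ a, f (insert y (a.erase x)) ≤ f m := by
      intro x hx y hy
      rw [Finset.mem_sdiff] at hy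
      refine hmax _ (Finset.mem_powersetCard.2 ⟨?_, ?_⟩)
      · exact Finset.insert_subset hy.1 ((Finset.erase_subset _ _).trans ha)
      · rw [Finset.card_insert_of_notMem (fun h => hy.2 (Finset.mem_of_mem_erase h)),
          Finset.card_erase_add_one hx, haw]
    have hsum := h a ha haw
    have hcard : ((U \ a).card : ℤ) = U.card - w := by
      rw [Finset.card_sdiff_of_subset ha, Nat.cast_sub (Finset.card_le_card ha), haw]
    -- Maximum principle: the neighbours of a maximum point average to the maximum, so each attains
    -- it.
    have h0 : ∑ x ∈ a, ∑ y ∈ U \ a, (f m - f (insert y (a.erase x))) = 0 := by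
      simp only [Finset.sum_sub_distrib, hsum, Finset.sum_const, hfa, nsmul_eq_mul, hcard, haw]
      ring
    have h1 := (Finset.sum_eq_zero_iff_of_nonneg (fun x hx => Finset.sum_nonneg
      (fun y hy => sub_nonneg.2 (hle x hx y hy)))).1 h0 x hx
    have h2 := (Finset.sum_eq_zero_iff_of_nonneg
      (fun y hy => sub_nonneg.2 (hle x hx y hy))).1 h1 y hy
    linarith
  rw [key s hs hsw, key t ht htw]

end Swaps

/-! ### Affine functions on slices -/

section Linear

theorem exists_eq_zero_of_sum_lt_card {α : Type*} {T : Finset α} {δ : α → ℤ} (h0 : ∀ a ∈ T, 0 ≤ δ a)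
    (h1 : ∑ a ∈ T, δ a < T.card) : ∃ a ∈ T, δ a = 0 := by
  by_contra! hne
  have : ∑ _a ∈ T, (1 : ℤ) ≤ ∑ a ∈ T, δ a := Finset.sum_le_sum fun a ha => by
    have := h0 a ha
    have := hne a ha
    omega
  simp at this
  omega

variable {α : Type*} [DecidableEq α]

theorem sum_insert_erase {T : Finset α} {x y : α} (hx : x ∈ T) (hy : y ∉ T) (δ : α → ℤ) :
    ∑ a ∈ insert y (T.erase x), δ a = ∑ a ∈ T, δ a + δ y - δ x := by
  rw [Finset.sum_insert (fun h => hy (Finset.mem_of_mem_erase h)), ← Finset.add_sum_erase T δ hx]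
  ring

/-- A function on the `(u + 1)`-element subsets of `V` with constant second differences is
affine. -/
theorem exists_affine_of_second_diff_const {V : Finset α} {u : ℕ} (hV : u + 3 ≤ V.card)
    {g : Finset α → ℤ}
    (hD : ∀ k ∈ V, ∀ l ∈ V, k ≠ l → ∀ R ⊆ V \ {k, l}, ∀ R' ⊆ V \ {k, l}, R.card = u →
      R'.card = u → g (insert k R) - g (insert l R) = g (insert k R') - g (insert l R')) :
    ∃ (c : ℤ) (δ : α → ℤ), ∀ T ⊆ V, T.card = u + 1 → g T = c + ∑ a ∈ T, δ a := by
  obtain ⟨z, hz⟩ : V.Nonempty := by rw [← Finset.card_pos]; omega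
  -- The slope at `k` is measured against the base point `z`; the value 0 is the correct one for `k
  -- = z`, and is arbitrary outside `V`.
  have hex : ∀ k, ∃ d : ℤ, k ∈ V → ∀ R ⊆ V \ {k, z}, R.card = u →
      g (insert k R) - g (insert z R) = d := by
    intro k
    by_cases hk : k ∈ V ∧ k ≠ z
    · have hc : u ≤ (V \ {k, z}).card := by
        have h1 := Finset.le_card_sdiff {k, z} V
        have h2 : ({k, z} : Finset α).card ≤ 2 := Finset.card_le_two
        omega
      obtain ⟨R, hR, hRu⟩ := Finset.exists_subset_card_eq hc
      exact ⟨_, fun _ R' hR' hu => hD k hk.1 z hz hk.2 R' hR' R hR hu hRu⟩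
    · refine ⟨0, fun hkV R _ _ => ?_⟩
      have : k = z := by tauto
      rw [this, sub_self]
  choose δ hδ using hex
  obtain ⟨T₀, hT₀, hT₀u⟩ := Finset.exists_subset_card_eq (show u + 1 ≤ V.card by omega)
  refine ⟨g T₀ - ∑ a ∈ T₀, δ a, δ, fun T hT hTu => ?_⟩
  suffices h : g T - ∑ a ∈ T, δ a = g T₀ - ∑ a ∈ T₀, δ a by linarith
  refine swap_induction (P := fun T => g T - ∑ a ∈ T, δ a = g T₀ - ∑ a ∈ T₀, δ a)
    ?_ hT₀ hT hT₀u hTu rfl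
  intro s hs hsu x hx y hy h
  rw [Finset.mem_sdiff] at hy
  rw [sum_insert_erase hx hy.2]
  have hyx : y ≠ x := fun h => hy.2 (h ▸ hx)
  -- `R` must avoid `z` too, so that the step from `x` to `y` can be read off as `δ y - δ x`; this
  -- is where `u + 3 ≤ V.card` enters.
  have hc : u ≤ (V \ {y, x, z}).card := by
    have h1 := Finset.le_card_sdiff {y, x, z} V
    have h2 : ({y, x, z} : Finset α).card ≤ 3 := Finset.card_le_three
    omega
  obtain ⟨R, hR, hRu⟩ := Finset.exists_subset_card_eq hc
  have hsub : ∀ A ⊆ ({y, x, z} : Finset α), R ⊆ V \ A :=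
    fun A hA => hR.trans (Finset.sdiff_subset_sdiff subset_rfl hA)
  have h1 := hD y hy.1 x (hs hx) hyx (s.erase x) (by
    intro a ha
    rw [Finset.mem_erase] at ha
    simp only [Finset.mem_sdiff, Finset.mem_insert, Finset.mem_singleton, not_or]
    exact ⟨hs ha.2, fun h => hy.2 (h ▸ ha.2), ha.1⟩) R
    (hsub _ (by intro a; simp only [Finset.mem_insert, Finset.mem_singleton]; tauto))
    (by rw [Finset.card_erase_of_mem hx, hsu]; rfl) hRu
  rw [Finset.insert_erase hx] at h1
  have h2 := hδ y hy.1 R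
    (hsub _ (by intro a; simp only [Finset.mem_insert, Finset.mem_singleton]; tauto)) hRu
  have h3 := hδ x (hs hx) R
    (hsub _ (by intro a; simp only [Finset.mem_insert, Finset.mem_singleton]; tauto)) hRu
  linarith

/-- The constant term of an affine eigenfunction. -/
theorem affine_eigen {V : Finset α} {v : ℕ} {μ c : ℤ} {δ : α → ℤ} {g : Finset α → ℤ}
    (hμ : μ = v * (V.card - v) - V.card) (h : SwapEigen V v μ 0 g)
    (hg : ∀ T ⊆ V, T.card = v → g T = c + ∑ a ∈ T, δ a) (hv : v ≤ V.card) :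
    V.card * c + v * ∑ a ∈ V, δ a = 0 := by
  -- The eigenvalue equation at a single `T` suffices; it says that the mean of `g` is zero.
  obtain ⟨T, hT, hTv⟩ := Finset.exists_subset_card_eq hv
  have h1 := h T hT hTv
  have h2 : ∀ x ∈ T, ∀ y ∈ V \ T, g (insert y (T.erase x)) = g T + δ y - δ x := by
    intro x hx y hy
    rw [Finset.mem_sdiff] at hy
    rw [hg _ (Finset.insert_subset hy.1 ((Finset.erase_subset _ _).trans hT)),
      sum_insert_erase hx hy.2, hg T hT hTv]
    · ring
    · rw [Finset.card_insert_of_notMem (fun h => hy.2 (Finset.mem_of_mem_erase h)),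
        Finset.card_erase_add_one hx, hTv]
  rw [Finset.sum_congr rfl (fun x hx => Finset.sum_congr rfl (h2 x hx))] at h1
  have hcard : ((V \ T).card : ℤ) = V.card - v := by
    rw [Finset.card_sdiff_of_subset hT, Nat.cast_sub (Finset.card_le_card hT), hTv]
  simp only [Finset.sum_sub_distrib, Finset.sum_add_distrib, Finset.sum_const, nsmul_eq_mul,
    hcard, hTv] at h1
  rw [← Finset.mul_sum] at h1
  have h3 := Finset.sum_sdiff (f := δ) hT
  rw [← h3]
  rw [hμ, hg T hT hTv] at h1
  linear_combination h1

/-- Among the subsets of given size, one consists of the largest values of `δ`. -/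
theorem exists_top_subset {V : Finset α} {v : ℕ} (hv : v ≤ V.card) (δ : α → ℤ) :
    ∃ T ⊆ V, T.card = v ∧ ∀ x ∈ T, ∀ y ∈ V \ T, δ y ≤ δ x := by
  obtain ⟨T, hT, hmax⟩ := (Finset.powersetCard v V).exists_max_image (fun T => ∑ a ∈ T, δ a)
    (Finset.powersetCard_nonempty.2 hv)
  rw [Finset.mem_powersetCard] at hT
  refine ⟨T, hT.1, hT.2, fun x hx y hy => ?_⟩
  rw [Finset.mem_sdiff] at hy
  have := hmax (insert y (T.erase x)) (Finset.mem_powersetCard.2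
    ⟨Finset.insert_subset hy.1 ((Finset.erase_subset _ _).trans hT.1), by
      rw [Finset.card_insert_of_notMem (fun h => hy.2 (Finset.mem_of_mem_erase h)),
        Finset.card_erase_add_one hx, hT.2]⟩)
  rw [sum_insert_erase hx hy.2] at this
  linarith

theorem exists_eq_single_of_sum_eq_one {T : Finset α} {δ : α → ℤ} (h0 : ∀ a ∈ T, 0 ≤ δ a)
    (h1 : ∑ a ∈ T, δ a = 1) : ∃ k ∈ T, ∀ a ∈ T, δ a = if a = k then 1 else 0 := by
  obtain ⟨k, hk, hne⟩ := Finset.exists_ne_zero_of_sum_ne_zero (h1.trans_ne one_ne_zero)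
  have h2 := Finset.add_sum_erase T δ hk
  have h3 : ∀ a ∈ T.erase k, 0 ≤ δ a := fun a ha => h0 a (Finset.mem_of_mem_erase ha)
  have h4 := Finset.sum_nonneg h3
  have h5 := h0 k hk
  have h6 : ∑ a ∈ T.erase k, δ a = 0 := by omega
  refine ⟨k, hk, fun a ha => ?_⟩
  split_ifs with h
  · subst h; omega
  · exact (Finset.sum_eq_zero_iff_of_nonneg h3).1 h6 a (Finset.mem_erase.2 ⟨h, ha⟩)

/-- An affine eigenfunction on a Johnson graph with values in `{-1, 0, 1}` is zero or a difference
of two coordinates. -/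
theorem eq_coordinate_difference {V : Finset α} {v : ℕ} {c : ℤ} {δ : α → ℤ} {g : Finset α → ℤ}
    (hv : 3 ≤ v) (hV : 2 * v < V.card)
    (hg : ∀ T ⊆ V, T.card = v → g T = c + ∑ a ∈ T, δ a)
    (hg1 : ∀ T ⊆ V, T.card = v → |g T| ≤ 1)
    (hc : V.card * c + v * ∑ a ∈ V, δ a = 0) :
    ∃ k ∈ V, ∃ l ∈ V, ∀ T ⊆ V, T.card = v →
      g T = (if k ∈ T then 1 else 0) - (if l ∈ T then 1 else 0) := by
  obtain ⟨T, hT, hTv, htop⟩ := exists_top_subset (show v ≤ V.card by omega) δ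
  have hVT : (V \ T).card = V.card - v := by rw [Finset.card_sdiff_of_subset hT, hTv]
  obtain ⟨B, hB, hBv, hbot⟩ := exists_top_subset (show v ≤ (V \ T).card by omega) (fun a => - δ a)
  have hM : ((V \ T) \ B).card = V.card - v - v := by rw [Finset.card_sdiff_of_subset hB, hBv, hVT]
  obtain ⟨z, hz⟩ : ((V \ T) \ B).Nonempty := by rw [← Finset.card_pos]; omega
  have hzV : z ∈ V \ T := (Finset.mem_sdiff.1 hz).1
  -- normalise so that the middle value is zero
  obtain ⟨ε, hε⟩ : ∃ ε : α → ℤ, ∀ a, ε a = δ a - δ z := ⟨_, fun _ => rfl⟩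
  obtain ⟨d, hd⟩ : ∃ d : ℤ, d = c + v * δ z := ⟨_, rfl⟩
  have hsum : ∀ A : Finset α, ∑ a ∈ A, ε a = ∑ a ∈ A, δ a - A.card * δ z := by
    intro A
    simp [hε, Finset.sum_sub_distrib]
  have hg' : ∀ A ⊆ V, A.card = v → g A = d + ∑ a ∈ A, ε a := by
    intro A hA hAv
    rw [hg A hA hAv, hsum, hAv, hd]
    ring
  have hBV : B ⊆ V := hB.trans Finset.sdiff_subset
  have hεT : ∀ a ∈ T, 0 ≤ ε a := fun a ha => by
    have := htop a ha z hzV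
    rw [hε]; omega
  have hεB : ∀ a ∈ B, 0 ≤ - ε a := fun a ha => by
    have := hbot a ha z hz
    rw [hε]; omega
  have hp := Finset.sum_nonneg hεT
  have hq := Finset.sum_nonneg hεB
  have hgT := hg1 T hT hTv
  have hgB := hg1 B hBV hBv
  rw [abs_le, hg' T hT hTv] at hgT
  rw [abs_le, hg' B hBV hBv] at hgB
  have hneg : ∑ a ∈ B, - ε a = - ∑ a ∈ B, ε a := Finset.sum_neg_distrib _
  -- The sums over `T` and `B` are at most 2 in absolute value, less than `v`, so `ε` vanishes
  -- somewhere in each, and the middle values are squeezed between.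
  have hεM : ∀ a ∈ (V \ T) \ B, ε a = 0 := by
    intro a ha
    obtain ⟨t, ht, ht0⟩ := exists_eq_zero_of_sum_lt_card hεT (by omega)
    obtain ⟨b, hb, hb0⟩ := exists_eq_zero_of_sum_lt_card hεB (by omega)
    have h1 := htop t ht a (Finset.mem_sdiff.1 ha).1
    have h2 := hbot b hb a ha
    rw [hε] at ht0 hb0 ⊢
    omega
  have hsV : ∑ a ∈ V, ε a = ∑ a ∈ T, ε a + ∑ a ∈ B, ε a := by
    rw [← Finset.sum_sdiff hT, ← Finset.sum_sdiff hB, Finset.sum_eq_zero hεM]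
    ring
  have hc' : V.card * d + v * (∑ a ∈ T, ε a + ∑ a ∈ B, ε a) = 0 := by
    rw [← hsV, hsum, hd]
    linear_combination hc
  have hVz : (2 * v : ℤ) < V.card := by exact_mod_cast hV
  -- For `d ≠ 0` the bounds on `g T` and `g B` leave at most `2 * v` to balance `V.card * d`, which
  -- is too little.
  have hd0 : d = 0 := by
    by_contra hne
    rcases lt_or_gt_of_ne hne with h | h <;> nlinarith
  rw [hd0] at hg' hc' hgT hgB
  have hpq : ∑ a ∈ T, ε a + ∑ a ∈ B, ε a = 0 := by
    have : v ≠ 0 := by omega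
    simpa [this] using hc'
  rcases (show ∑ a ∈ T, ε a = 0 ∨ ∑ a ∈ T, ε a = 1 by omega) with h | h
  · have hT0 := (Finset.sum_eq_zero_iff_of_nonneg hεT).1 h
    have hB0 := (Finset.sum_eq_zero_iff_of_nonneg hεB).1 (by omega)
    refine ⟨z, (Finset.mem_sdiff.1 hzV).1, z, (Finset.mem_sdiff.1 hzV).1, fun A hA hAv => ?_⟩
    rw [hg' A hA hAv, Finset.sum_eq_zero, sub_self, add_zero]
    intro a ha
    by_cases haT : a ∈ T
    · exact hT0 a haT
    by_cases haB : a ∈ B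
    · have := hB0 a haB
      omega
    exact hεM a (by simp [hA ha, haT, haB])
  · obtain ⟨k, hk, hkε⟩ := exists_eq_single_of_sum_eq_one hεT h
    obtain ⟨l, hl, hlε⟩ := exists_eq_single_of_sum_eq_one hεB (by omega)
    refine ⟨k, hT hk, l, hBV hl, fun A hA hAv => ?_⟩
    have : ∀ a ∈ A, ε a = (if a = k then 1 else 0) - (if a = l then 1 else 0) := by
      intro a ha
      by_cases haT : a ∈ T
      · have : a ≠ l := by
          rintro rfl
          exact (Finset.mem_sdiff.1 (hB hl)).2 haT
        rw [hkε a haT, if_neg this, sub_zero]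
      have hak : a ≠ k := fun h => haT (h ▸ hk)
      by_cases haB : a ∈ B
      · have := hlε a haB
        rw [if_neg hak]
        omega
      have hal : a ≠ l := fun h => haB (h ▸ hl)
      rw [if_neg hak, if_neg hal, hεM a (by simp [hA ha, haT, haB]), sub_zero]
    rw [hg' A hA hAv, Finset.sum_congr rfl this, Finset.sum_sub_distrib, Finset.sum_ite_eq',
      Finset.sum_ite_eq', zero_add]

end Linear

/-! ### Differences of the indicator function are differences of coordinates -/

section Combinatorics

variable {α : Type*} [DecidableEq α] [Fintype α]

theorem SwapEigen.exists_coordinate_difference {w : ℕ} {c : ℤ} {f : Finset α → ℤ} (hw : 3 < w)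
    (hn : 2 * w < Fintype.card α)
    (h : SwapEigen Finset.univ w (((w : ℤ) - 2) * (Fintype.card α - w - 2) - 2) c f)
    (hf : ∀ s, f s = 0 ∨ f s = 1) {i j : α} (hij : i ≠ j) :
    ∃ k l, k ≠ i ∧ k ≠ j ∧ l ≠ i ∧ l ≠ j ∧ ∀ T : Finset α, i ∉ T → j ∉ T → T.card + 1 = w →
      f (insert i T) - f (insert j T) = (if k ∈ T then 1 else 0) - (if l ∈ T then 1 else 0) := by
  obtain ⟨u, rfl⟩ : ∃ u, w = u + 1 + 1 := ⟨w - 2, by omega⟩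
  have hVc : (Finset.univ \ {i, j}).card + 2 = Fintype.card α := by
    rw [← Finset.card_pair hij, Finset.card_sdiff_add_card_eq_card (Finset.subset_univ _),
      Finset.card_univ]
  have h1 := h.sub hij (Finset.mem_univ i) (Finset.mem_univ j)
  obtain ⟨V, hV⟩ : ∃ V, V = Finset.univ \ {i, j} := ⟨_, rfl⟩
  rw [← hV] at h1 hVc
  have hmem : ∀ a, a ∈ V ↔ a ≠ i ∧ a ≠ j := by simp [hV]
  have hVc' : (Fintype.card α : ℤ) = V.card + 2 := by exact_mod_cast hVc.symm
  obtain ⟨c', δ, hδ⟩ := exists_affine_of_second_diff_const (V := V) (u := u) (by omega)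
    (g := fun T => f (insert i T) - f (insert j T)) (by
      intro k hk l hl hkl R hR R' hR' hu hu'
      have hc : (V \ {k, l}).card + 2 = V.card := by
        rw [← Finset.card_pair hkl, Finset.card_sdiff_add_card_eq_card]
        exact Finset.insert_subset hk (Finset.singleton_subset_iff.2 hl)
      have h2 := h1.sub hkl hk hl
      -- After two differences the eigenvalue is the degree of `J(n-4, w-2)`.
      have hμ : ((u + 1 + 1 : ℕ) - 2 : ℤ) * (Fintype.card α - (u + 1 + 1 : ℕ) - 2) - 2 + 1 + 1 =
          u * ((V \ {k, l}).card - u) := by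
        rw [hVc', ← hc]
        push_cast
        ring
      rw [hμ] at h2
      exact h2.const hR hR' hu hu')
  have h3 := affine_eigen (by rw [hVc']; push_cast; ring) h1 hδ (by omega)
  obtain ⟨k, hk, l, hl, hkl⟩ := eq_coordinate_difference (by omega) (by omega) hδ (by
    intro T _ _
    rw [abs_le]
    have h1 := hf (insert i T)
    have h2 := hf (insert j T)
    omega) h3
  rw [hmem] at hk hl
  refine ⟨k, l, hk.1, hk.2, hl.1, hl.2, fun T hi hj hT => hkl T (fun a ha => ?_) (by omega)⟩
  rw [hmem]
  exact ⟨fun h => hi (h ▸ ha), fun h => hj (h ▸ ha)⟩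

/-- There are sets of given size that contain `A` and avoid `B`. -/
theorem exists_card_eq_superset_disjoint {A B : Finset α} {r : ℕ} (hAB : Disjoint A B)
    (hA : A.card ≤ r) (hB : r + B.card ≤ Fintype.card α) :
    ∃ R, A ⊆ R ∧ Disjoint R B ∧ R.card = r := by
  have hc : Bᶜ.card + B.card = Fintype.card α := Finset.card_compl_add_card B
  obtain ⟨R, h1, h2, h3⟩ := Finset.exists_subsuperset_card_eq
    (Finset.subset_compl_iff_disjoint_right.2 hAB) hA (show r ≤ Bᶜ.card by omega)
  exact ⟨R, h1, Finset.subset_compl_iff_disjoint_right.1 h2, h3⟩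

theorem exists_mem_pair_ne {α : Type*} {i j p q : α} (hij : i ≠ j) (hpq : p ≠ q) :
    ∃ a, (a = i ∨ a = j) ∧ a ≠ q ∧ (p = i ∨ p = j → p = a) := by
  by_cases h : p = i ∨ p = j
  · exact ⟨p, h, hpq, fun _ => rfl⟩
  · by_cases h' : q = i
    · exact ⟨j, Or.inr rfl, by rw [h']; exact hij.symm, fun h'' => absurd h'' h⟩
    · exact ⟨i, Or.inl rfl, fun h => h' h.symm, fun h'' => absurd h'' h⟩

/-- `f` takes equal values on sets with `w` elements that differ by exchanging two elements
outside of `{i, j, k, l}`, provided the difference for each pair is a difference of coordinates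
and `f` is constant on the sets that contain a given edge of the four-cycle `i, k, j, l`. -/
theorem eq_of_swap_outside {w : ℕ} {f : Finset α → ℤ} (hw : 3 < w) (hn : 2 * w < Fintype.card α)
    {i j k l : α} (hd : [i, j, k, l].Nodup) {v : α → α → ℤ}
    (hv : ∀ a, a = i ∨ a = j → ∀ b, b = k ∨ b = l → ∀ R : Finset α,
      Disjoint R {i, j, k, l} → R.card + 2 = w → f (insert a (insert b R)) = v a b)
    {m m' p q : α} (hm : m ∉ ({i, j, k, l} : Finset α)) (hm' : m' ∉ ({i, j, k, l} : Finset α))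
    (hpm : p ≠ m) (hpm' : p ≠ m')
    (hpq : ∀ T : Finset α, m ∉ T → m' ∉ T → T.card + 1 = w →
      f (insert m T) - f (insert m' T) = (if p ∈ T then 1 else 0) - (if q ∈ T then 1 else 0)) :
    p = q := by
  by_contra hne
  simp only [List.nodup_cons, List.mem_cons, List.not_mem_nil, or_false, not_or] at hd
  -- The edge `{a, b}` avoids `q` and contains `p` if `p` lies on the cycle; otherwise `R` will
  -- contain `p`. Then the difference at `{a, b} ∪ R` is 1, whereas both values are `v a b`.
  obtain ⟨a, ha, haq, hap⟩ := exists_mem_pair_ne hd.1.1 hne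
  obtain ⟨b, hb, hbq, hbp⟩ := exists_mem_pair_ne hd.2.2.1 hne
  have hX : ({i, j, k, l} : Finset α).card ≤ 4 := Finset.card_le_four
  have haX : a ∈ ({i, j, k, l} : Finset α) := by
    rcases ha with rfl | rfl <;> simp
  have hbX : b ∈ ({i, j, k, l} : Finset α) := by
    rcases hb with rfl | rfl <;> simp
  have hab : a ≠ b := by grind
  have hpX : p ∈ ({i, j, k, l} : Finset α) → p = a ∨ p = b := by grind
  generalize ({i, j, k, l} : Finset α) = X at *
  obtain ⟨R, hpR, hR, hRc⟩ := exists_card_eq_superset_disjoint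
    (A := {p} \ X) (B := insert m (insert m' (insert q X))) (r := w - 3) (by
      rw [Finset.disjoint_left]
      intro x hx
      rw [Finset.mem_sdiff, Finset.mem_singleton] at hx
      obtain ⟨rfl, hx⟩ := hx
      simp only [Finset.mem_insert, not_or]
      exact ⟨hpm, hpm', hne, hx⟩)
    (by
      have := Finset.card_le_card (Finset.sdiff_subset (s := {p}) (t := X))
      rw [Finset.card_singleton] at this
      omega)
    (by
      have h1 := Finset.card_insert_le m (insert m' (insert q X))
      have h2 := Finset.card_insert_le m' (insert q X)
      have h3 := Finset.card_insert_le q X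
      omega)
  simp only [Finset.disjoint_insert_right] at hR
  obtain ⟨hmR, hmR', hqR, hRX⟩ := hR
  have haR : a ∉ R := fun h => Finset.disjoint_left.1 hRX h haX
  have hbR : b ∉ R := fun h => Finset.disjoint_left.1 hRX h hbX
  have hval : ∀ x, x ∉ R → x ∉ X → f (insert x (insert a (insert b R))) = v a b := by
    intro x hxR hx
    rw [Finset.insert_comm x a, Finset.insert_comm x b]
    exact hv a ha b hb _ (Finset.disjoint_insert_left.2 ⟨hx, hRX⟩)
      (by rw [Finset.card_insert_of_notMem hxR]; omega)
  have hpT : p ∈ insert a (insert b R) := by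
    rw [Finset.mem_insert, Finset.mem_insert]
    by_cases h : p ∈ X
    · rcases hpX h with h | h <;> simp [h]
    · exact Or.inr (Or.inr (hpR (by simpa using h)))
  have hqT : q ∉ insert a (insert b R) := by
    simp only [Finset.mem_insert, not_or]
    exact ⟨haq.symm, hbq.symm, hqR⟩
  have hT : ∀ x, x ∉ R → x ∉ X → x ∉ insert a (insert b R) := by
    intro x hxR hx
    simp only [Finset.mem_insert, not_or]
    exact ⟨fun h => hx (h ▸ haX), fun h => hx (h ▸ hbX), hxR⟩
  have := hpq (insert a (insert b R)) (hT m hmR hm) (hT m' hmR' hm')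
    (by
      rw [Finset.card_insert_of_notMem, Finset.card_insert_of_notMem hbR, hRc]
      · omega
      · simp only [Finset.mem_insert, not_or]; exact ⟨hab, haR⟩)
  rw [hval m hmR hm, hval m' hmR' hm', if_pos hpT, if_neg hqT] at this
  omega

end Combinatorics

/-! ### Excluding nonzero differences -/

section FourCycle

variable {α : Type*} [DecidableEq α] [Fintype α]

/-- If exchanging two elements outside of `X` does not change `f`, then `f` depends only on the
intersection with `X`. -/
theorem eq_of_inter_eq {w : ℕ} {f : Finset α → ℤ} {X : Finset α}
    (h : ∀ m ∉ X, ∀ m' ∉ X, ∀ T : Finset α, m ∉ T → m' ∉ T → T.card + 1 = w →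
      f (insert m T) = f (insert m' T))
    {B R R' : Finset α} (hB : B ⊆ X) (hR : Disjoint R X) (hR' : Disjoint R' X)
    (hc : B.card + R.card = w) (hc' : B.card + R'.card = w) : f (B ∪ R) = f (B ∪ R') := by
  refine swap_induction (U := Xᶜ) (w := R'.card) (P := fun R => f (B ∪ R) = f (B ∪ R')) ?_
    (Finset.subset_compl_iff_disjoint_right.2 hR') (Finset.subset_compl_iff_disjoint_right.2 hR)
    rfl (by omega) rfl
  intro s hs hsc x hx y hy hfs
  rw [← hfs]
  have hxX : x ∉ X := Finset.mem_compl.1 (hs hx)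
  rw [Finset.mem_sdiff, Finset.mem_compl] at hy
  have hsX : Disjoint B s :=
    (Finset.subset_compl_iff_disjoint_right.1 hs).symm.mono_left hB
  have h1 : B ∪ s = insert x (B ∪ s.erase x) := by
    rw [← Finset.union_insert, Finset.insert_erase hx]
  rw [h1, Finset.union_insert]
  refine h y hy.1 x hxX _ ?_ ?_ ?_
  · rw [Finset.mem_union, Finset.mem_erase]
    rintro (h | h)
    · exact hy.1 (hB h)
    · exact hy.2 h.2
  · rw [Finset.mem_union, Finset.mem_erase]
    rintro (h | h)
    · exact hxX (hB h)
    · exact h.1 rfl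
  · rw [Finset.card_union_of_disjoint (hsX.mono_right (Finset.erase_subset _ _)), add_assoc,
      Finset.card_erase_add_one hx, hsc, hc']

/-- `R` varies freely outside `Y`: choosing it to avoid `p` pins `p` to `k`, and if `q` were outside
`Y`, an `R` containing `q` would violate `hL`. -/
theorem coordinates_of_indicator_sub {Y : Finset α} {r : ℕ} (hr : 1 ≤ r)
    (hY : r + Y.card + 1 ≤ Fintype.card α) {k l p q : α} (hkl : k ≠ l) (hk : k ∈ Y)
    (hK : ∀ R : Finset α, Disjoint R Y → R.card = r →
      (if p ∈ insert k R then (1 : ℤ) else 0) - (if q ∈ insert k R then 1 else 0) = 1)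
    (hL : ∀ R : Finset α, Disjoint R Y → R.card = r →
      (if p ∈ insert l R then (1 : ℤ) else 0) - (if q ∈ insert l R then 1 else 0) = 0) :
    p = k ∧ q ∈ Y ∧ q ≠ k ∧ q ≠ l := by
  have hKm : ∀ R : Finset α, Disjoint R Y → R.card = r → p ∈ insert k R ∧ q ∉ insert k R := by
    intro R h1 h2
    have := hK R h1 h2
    split_ifs at this with h3 h4 h4 <;> simp_all
  obtain ⟨R, -, hR, hRc⟩ := exists_card_eq_superset_disjoint (A := ∅) (B := insert p Y) (r := r)
    (Finset.disjoint_empty_left _) (by simp) (by have := Finset.card_insert_le p Y; omega)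
  rw [Finset.disjoint_insert_right] at hR
  obtain ⟨hp, hq⟩ := hKm R hR.2 hRc
  have hpk : p = k := (Finset.mem_insert.1 hp).resolve_right hR.1
  subst hpk
  have hLm : ∀ R : Finset α, Disjoint R Y → R.card = r → q ∉ insert l R := by
    intro R h1 h2 h3
    have := hL R h1 h2
    have hpR : p ∉ insert l R := by
      rw [Finset.mem_insert]
      rintro (h | h)
      · exact hkl h
      · exact Finset.disjoint_left.1 h1 h hk
    rw [if_neg hpR, if_pos h3] at this
    omega
  refine ⟨rfl, ?_, fun h => hq (h ▸ Finset.mem_insert_self _ _),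
    fun h => hLm R hR.2 hRc (h ▸ Finset.mem_insert_self _ _)⟩
  by_contra hqY
  obtain ⟨R', hqR', hR', hRc'⟩ := exists_card_eq_superset_disjoint (A := {q}) (B := Y) (r := r)
    (Finset.disjoint_singleton_left.2 hqY) (by simpa using hr) (by omega)
  exact hLm R' hR' hRc' (Finset.mem_insert_of_mem (hqR' (Finset.mem_singleton_self q)))

theorem not_isFourCycle {w : ℕ} {f : Finset α → ℤ} (hw : 3 < w) (hn : 2 * w < Fintype.card α)
    (hf : ∀ s, f s = 0 ∨ f s = 1)
    (H : ∀ i j, i ≠ j → ∃ k l, k ≠ i ∧ k ≠ j ∧ l ≠ i ∧ l ≠ j ∧ ∀ T : Finset α, i ∉ T → j ∉ T →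
      T.card + 1 = w →
        f (insert i T) - f (insert j T) = (if k ∈ T then 1 else 0) - (if l ∈ T then 1 else 0))
    {i j k l : α} (hd : [i, j, k, l].Nodup)
    (h : ∀ T : Finset α, i ∉ T → j ∉ T → T.card + 1 = w →
      f (insert i T) - f (insert j T) = (if k ∈ T then 1 else 0) - (if l ∈ T then 1 else 0)) :
    False := by
  obtain ⟨X, hX⟩ : ∃ X : Finset α, X = {i, j, k, l} := ⟨_, rfl⟩
  have hXc : X.card ≤ 4 := hX ▸ Finset.card_le_four
  have hmem : ∀ a, a ∈ X ↔ a = i ∨ a = j ∨ a = k ∨ a = l := by simp [hX]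
  have hiX : i ∈ X := by simp [hX]
  have hjX : j ∈ X := by simp [hX]
  have hkX : k ∈ X := by simp [hX]
  have hlX : l ∈ X := by simp [hX]
  have hd' := hd
  simp only [List.nodup_cons, List.mem_cons, List.not_mem_nil, or_false, not_or] at hd'
  have hij : i ≠ j := hd'.1.1
  have hik : i ≠ k := hd'.1.2.1
  have hil : i ≠ l := hd'.1.2.2
  have hjk : j ≠ k := hd'.2.1.1
  have hjl : j ≠ l := hd'.2.1.2
  have hkl : k ≠ l := hd'.2.2.1
  clear hd'
  have hnot : ∀ {R : Finset α} {a b : α}, Disjoint R X → a ∈ X → a ≠ b → a ∉ insert b R := by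
    intro R a b hR ha hab
    rw [Finset.mem_insert, not_or]
    exact ⟨hab, fun h => Finset.disjoint_left.1 hR h ha⟩
  have hcard : ∀ {R : Finset α} {a : α}, Disjoint R X → a ∈ X → R.card + 2 = w →
      (insert a R).card + 1 = w := by
    intro R a hR ha hc
    rw [Finset.card_insert_of_notMem (fun h => Finset.disjoint_left.1 hR h ha)]
    omega
  -- values on the four-cycle
  have hK : ∀ R : Finset α, Disjoint R X → R.card + 2 = w →
      f (insert i (insert k R)) = 1 ∧ f (insert j (insert k R)) = 0 := by
    intro R hR hc
    have h1 := h (insert k R) (hnot hR hiX hik) (hnot hR hjX hjk) (hcard hR hkX hc)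
    rw [if_pos (Finset.mem_insert_self _ _), if_neg (hnot hR hlX hkl.symm)] at h1
    have h2 := hf (insert i (insert k R))
    have h3 := hf (insert j (insert k R))
    omega
  have hL : ∀ R : Finset α, Disjoint R X → R.card + 2 = w →
      f (insert i (insert l R)) = 0 ∧ f (insert j (insert l R)) = 1 := by
    intro R hR hc
    have h1 := h (insert l R) (hnot hR hiX hil) (hnot hR hjX hjl) (hcard hR hlX hc)
    rw [if_pos (Finset.mem_insert_self _ _), if_neg (hnot hR hkX hkl)] at h1
    have h2 := hf (insert i (insert l R))
    have h3 := hf (insert j (insert l R))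
    omega
  have hswap : ∀ m ∉ X, ∀ m' ∉ X, ∀ T : Finset α, m ∉ T → m' ∉ T → T.card + 1 = w →
      f (insert m T) = f (insert m' T) := by
    intro m hm m' hm' T hT hT' hTc
    by_cases hmm : m = m'
    · rw [hmm]
    obtain ⟨p, q, hpm, hpm', -, -, hpq⟩ := H m m' hmm
    have := eq_of_swap_outside hw hn hd (v := fun a b => if (a = i ↔ b = k) then 1 else 0)
      (by
        intro a ha b hb R hR hc
        rw [← hX] at hR
        rcases ha with rfl | rfl <;> rcases hb with rfl | rfl
        · simp [hK R hR hc]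
        · simp [hL R hR hc, hkl.symm]
        · simp [hK R hR hc, hij.symm]
        · simp [hL R hR hc, hij.symm, hkl.symm]) (hX ▸ hm) (hX ▸ hm') hpm hpm' hpq
    have h1 := hpq T hT hT' hTc
    rw [this, sub_self] at h1
    linarith
  obtain ⟨m, hm⟩ : ∃ m, m ∉ X := by
    by_contra! hall
    have := Finset.card_le_card (fun a _ => hall a : Finset.univ ⊆ X)
    rw [Finset.card_univ] at this
    omega
  have hYc := Finset.card_insert_le m X
  obtain ⟨R₀, -, hR₀, hR₀c⟩ := exists_card_eq_superset_disjoint (A := ∅) (B := X) (r := w)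
    (Finset.disjoint_empty_left _) (by simp) (by omega)
  have h0 : ∀ R : Finset α, Disjoint R X → R.card = w → f R = f R₀ := by
    intro R hR hc
    simpa using eq_of_inter_eq hswap (B := ∅) (by simp) hR hR₀ (by simpa) (by simpa)
  have hm0 : ∀ R : Finset α, Disjoint R (insert m X) → R.card + 1 = w →
      f (insert m R) = f R₀ := by
    intro R hR hc
    rw [Finset.disjoint_insert_right] at hR
    exact h0 _ (Finset.disjoint_insert_left.2 ⟨hm, hR.2⟩)
      (by rw [Finset.card_insert_of_notMem hR.1, hc])
  have h1 : ∀ a ∈ X, ∀ R : Finset α, Disjoint R X → R.card + 1 = w →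
      f (insert a R) = f R₀ := by
    intro a ha R hR hc
    have hcomp : ∀ R' : Finset α, Disjoint R' X → R'.card + 1 = w →
        f (insert a R) = f (insert a R') := fun R' hR' hc' =>
      eq_of_inter_eq hswap (B := {a}) (Finset.singleton_subset_iff.2 ha) hR hR'
        (by rw [Finset.card_singleton]; omega) (by rw [Finset.card_singleton]; omega)
    obtain ⟨p, q, -, -, -, -, hpq⟩ := H a m (fun h => hm (h ▸ ha))
    -- The left side does not depend on `R'`. Avoiding `p` makes it at most 0, avoiding `q` at least
    -- 0.
    have hval : ∀ x, ∃ R' : Finset α, x ∉ R' ∧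
        f (insert a R) - f R₀ = (if p ∈ R' then 1 else 0) - (if q ∈ R' then 1 else 0) := by
      intro x
      obtain ⟨R', -, hR', hR'c⟩ := exists_card_eq_superset_disjoint (A := ∅)
        (B := insert x (insert m X)) (r := w - 1) (Finset.disjoint_empty_left _) (by simp)
        (by have := Finset.card_insert_le x (insert m X); omega)
      rw [Finset.disjoint_insert_right] at hR'
      have hR'm := (Finset.disjoint_insert_right.1 hR'.2)
      refine ⟨R', hR'.1, ?_⟩
      rw [← hpq R' (fun h => Finset.disjoint_left.1 hR'm.2 h ha) hR'm.1 (by omega),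
        hcomp R' hR'm.2 (by omega), hm0 R' hR'.2 (by omega)]
    obtain ⟨R₁, hR₁, hv₁⟩ := hval p
    obtain ⟨R₂, hR₂, hv₂⟩ := hval q
    rw [if_neg hR₁] at hv₁
    rw [if_neg hR₂] at hv₂
    split_ifs at hv₁ hv₂ <;> omega
  obtain ⟨p, q, hpi, hpm, hqi, hqm, hpq⟩ := H i m (fun h => hm (h ▸ hiX))
  have hval : ∀ a ∈ X, a ≠ i → ∀ R : Finset α, Disjoint R (insert m X) → R.card = w - 2 →
      (if p ∈ insert a R then (1 : ℤ) else 0) - (if q ∈ insert a R then 1 else 0) =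
        f (insert i (insert a R)) - f R₀ := by
    intro a ha hai R hR hc
    rw [Finset.disjoint_insert_right] at hR
    rw [← hpq (insert a R) (hnot hR.2 hiX hai.symm) (by
      rw [Finset.mem_insert, not_or]
      exact ⟨fun h => hm (h ▸ ha), hR.1⟩) (hcard hR.2 ha (by omega)),
      Finset.insert_comm m a, h1 a ha (insert m R) (Finset.disjoint_insert_left.2 ⟨hm, hR.2⟩)
        (by rw [Finset.card_insert_of_notMem hR.1]; omega)]
  obtain ⟨R₁, -, hR₁, hR₁c⟩ := exists_card_eq_superset_disjoint (A := ∅)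
    (B := insert m X) (r := w - 2) (Finset.disjoint_empty_left _) (by simp) (by omega)
  have hR₁X := (Finset.disjoint_insert_right.1 hR₁).2
  have hj := hval j hjX hij.symm R₁ hR₁ hR₁c
  have hfj := hf (insert i (insert j R₁))
  have hYj : ∀ x ∈ insert m X, x ≠ i → x ≠ m → x ≠ k → x ≠ l → x = j := by
    intro x hx
    rw [Finset.mem_insert, hmem] at hx
    tauto
  -- If `f R₀ = 0`, then `p = k` and `q = j`, so `f` would be -1 on `{i, j} ∪ R₁`; if `f R₀ = 1`,
  -- then `q = l` and `p = j`, so it would be 2.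
  rcases hf R₀ with hz | hz
  · obtain ⟨rfl, hqY, hqk, hql⟩ := coordinates_of_indicator_sub (Y := insert m X) (r := w - 2)
      (p := p) (q := q) (by omega) (by omega) hkl (Finset.mem_insert_of_mem hkX)
      (fun R hR hc => by
        rw [hval k hkX hik.symm R hR hc, hz,
          (hK R (Finset.disjoint_insert_right.1 hR).2 (by omega)).1, sub_zero])
      (fun R hR hc => by
        rw [hval l hlX hil.symm R hR hc, hz,
          (hL R (Finset.disjoint_insert_right.1 hR).2 (by omega)).1, sub_zero])
    obtain rfl := hYj q hqY hqi hqm hqk hql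
    rw [if_neg (hnot hR₁X hkX hjk.symm), if_pos (Finset.mem_insert_self _ _), hz] at hj
    omega
  · obtain ⟨rfl, hpY, hpl, hpk⟩ := coordinates_of_indicator_sub (Y := insert m X) (r := w - 2)
      (p := q) (q := p) (by omega) (by omega) hkl.symm (Finset.mem_insert_of_mem hlX)
      (fun R hR hc => by
        have := hval l hlX hil.symm R hR hc
        rw [hz, (hL R (Finset.disjoint_insert_right.1 hR).2 (by omega)).1] at this
        linarith)
      (fun R hR hc => by
        have := hval k hkX hik.symm R hR hc
        rw [hz, (hK R (Finset.disjoint_insert_right.1 hR).2 (by omega)).1] at this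
        linarith)
    obtain rfl := hYj p hpY hpi hpm hpk hpl
    rw [if_neg (hnot hR₁X hlX hjl.symm), if_pos (Finset.mem_insert_self _ _), hz] at hj
    omega

/-- A function with values `0` and `1` on the vertices of a Johnson graph is constant if, up to an
additive constant, it is an eigenfunction for the eigenvalue `λ_2`. -/
theorem SwapEigen.eq_of_zero_one {w : ℕ} {c : ℤ} {f : Finset α → ℤ} (hw : 3 < w)
    (hn : 2 * w < Fintype.card α)
    (h : SwapEigen Finset.univ w (((w : ℤ) - 2) * (Fintype.card α - w - 2) - 2) c f)
    (hf : ∀ s, f s = 0 ∨ f s = 1) {s t : Finset α} (hs : s.card = w) (ht : t.card = w) :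
    f s = f t := by
  have H := fun i j => h.exists_coordinate_difference hw hn hf (i := i) (j := j)
  have := @eq_of_inter_eq α _ _ w f ∅ (by
    intro i _ j _ T hi hj hT
    by_cases hij : i = j
    · rw [hij]
    obtain ⟨k, l, hki, hkj, hli, hlj, hkl⟩ := H i j hij
    have h1 := hkl T hi hj hT
    by_cases hkl' : k = l
    · rw [hkl', sub_self] at h1
      linarith
    · refine (not_isFourCycle hw hn hf H (i := i) (j := j) (k := k) (l := l) ?_ hkl).elim
      simp only [List.nodup_cons, List.mem_cons, List.not_mem_nil, or_false, not_or]
      simp [hij, hki.symm, hli.symm, hkj.symm, hlj.symm, hkl']) ∅ s t subset_rfl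
    (Finset.disjoint_empty_right _) (Finset.disjoint_empty_right _) (by simpa) (by simpa)
  simpa using this

end FourCycle

/-! ### From equitable partitions to eigenfunctions -/

section Johnson

open Classical in
/-- The indicator function of a set of vertices of `J(n, w)`, extended by zero to all sets. -/
noncomputable def cellIndicator {n w : ℕ} (C : Set {s : Finset (Fin n) // s.card = w})
    (t : Finset (Fin n)) : ℤ :=
  if ∃ h : t.card = w, (⟨t, h⟩ : {s : Finset (Fin n) // s.card = w}) ∈ C then 1 else 0

theorem cellIndicator_eq_zero_or_one {n w : ℕ} (C : Set {s : Finset (Fin n) // s.card = w})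
    (t : Finset (Fin n)) : cellIndicator C t = 0 ∨ cellIndicator C t = 1 := by
  unfold cellIndicator
  split_ifs <;> simp

theorem cellIndicator_of_mem {n w : ℕ} {C : Set {s : Finset (Fin n) // s.card = w}}
    {v : {s : Finset (Fin n) // s.card = w}} (h : v ∈ C) : cellIndicator C v.1 = 1 :=
  if_pos ⟨v.2, h⟩

theorem cellIndicator_of_notMem {n w : ℕ} {C : Set {s : Finset (Fin n) // s.card = w}}
    {v : {s : Finset (Fin n) // s.card = w}} (h : v ∉ C) : cellIndicator C v.1 = 0 :=
  if_neg fun ⟨_, h'⟩ => h h'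

theorem exists_swap_iff {α : Type*} [DecidableEq α] {s t : Finset α} (hst : s.card = t.card) :
    (s ∩ t).card + 1 = s.card ↔ ∃ x ∈ s, ∃ y, y ∉ s ∧ insert y (s.erase x) = t := by
  constructor
  · intro h
    have h1 := Finset.card_sdiff_add_card_inter s t
    have h2 := Finset.card_sdiff_add_card_inter t s
    rw [Finset.inter_comm] at h2
    obtain ⟨x, hx⟩ := Finset.card_eq_one.1 (show (s \ t).card = 1 by omega)
    obtain ⟨y, hy⟩ := Finset.card_eq_one.1 (show (t \ s).card = 1 by omega)
    have hx' : ∀ a, a ∈ s ∧ a ∉ t ↔ a = x := fun a => by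
      rw [← Finset.mem_sdiff, hx, Finset.mem_singleton]
    have hy' : ∀ a, a ∈ t ∧ a ∉ s ↔ a = y := fun a => by
      rw [← Finset.mem_sdiff, hy, Finset.mem_singleton]
    refine ⟨x, ((hx' x).2 rfl).1, y, ((hy' y).2 rfl).2, ?_⟩
    ext a
    rw [Finset.mem_insert, Finset.mem_erase, ← hy', Ne, ← hx']
    tauto
  · rintro ⟨x, hx, y, hy, rfl⟩
    rw [Finset.inter_insert_of_notMem hy, Finset.inter_eq_right.2 (Finset.erase_subset _ _),
      Finset.card_erase_add_one hx]

theorem swap_injOn {α : Type*} [DecidableEq α] (s : Finset α) :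
    Set.InjOn (fun p : α × α => insert p.2 (s.erase p.1)) {p | p.1 ∈ s ∧ p.2 ∉ s} := by
  rintro ⟨x, y⟩ ⟨hx, hy⟩ ⟨x', y'⟩ ⟨hx', hy'⟩ h
  have hmem : ∀ a, a = y ∨ a ≠ x ∧ a ∈ s ↔ a = y' ∨ a ≠ x' ∧ a ∈ s := fun a => by
    simpa using Finset.ext_iff.1 h a
  dsimp only at hx hy hx' hy'
  have h1 := (hmem y).1 (Or.inl rfl)
  have h2 := hmem x
  have hyy : y = y' := by tauto
  have hxx : x = x' := by
    by_contra hne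
    have h3 : x = y := by tauto
    exact hy (h3 ▸ hx)
  rw [hxx, hyy]

/-- Each neighbour arises from exactly one swap, by `exists_swap_iff` and `swap_injOn`. -/
theorem ncard_neighborSet_inter {n w : ℕ} (C : Set {s : Finset (Fin n) // s.card = w})
    (v : {s : Finset (Fin n) // s.card = w}) :
    (((johnsonGraph n w).neighborSet v ∩ C).ncard : ℤ) =
      ∑ x ∈ v.1, ∑ y ∈ Finset.univ \ v.1, cellIndicator C (insert y (v.1.erase x)) := by
  classical
  obtain ⟨P, hP⟩ : ∃ P : Finset (Fin n × Fin n), P = (v.1 ×ˢ (Finset.univ \ v.1)).filter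
      fun p => ∃ h : (insert p.2 (v.1.erase p.1)).card = w,
        (⟨_, h⟩ : {s : Finset (Fin n) // s.card = w}) ∈ C := ⟨_, rfl⟩
  have hsum : ∑ x ∈ v.1, ∑ y ∈ Finset.univ \ v.1, cellIndicator C (insert y (v.1.erase x)) =
      P.card := by
    rw [← Finset.sum_product', hP, Finset.card_filter]
    push_cast
    rfl
  have himage : Subtype.val '' ((johnsonGraph n w).neighborSet v ∩ C) =
      (P.image fun p => insert p.2 (v.1.erase p.1) : Finset (Finset (Fin n))) := by
    ext t
    simp only [Set.mem_image, Set.mem_inter_iff, SimpleGraph.mem_neighborSet, Finset.coe_image,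
      Finset.mem_coe, hP, Finset.mem_filter, Finset.mem_product, Finset.mem_sdiff,
      Finset.mem_univ, true_and]
    constructor
    · rintro ⟨u, ⟨hadj, huC⟩, rfl⟩
      obtain ⟨x, hx, y, hy, hxy⟩ := (exists_swap_iff (v.2.trans u.2.symm)).1
        (show (v.1 ∩ u.1).card + 1 = v.1.card from hadj.trans v.2.symm)
      refine ⟨(x, y), ⟨⟨hx, hy⟩, ?_⟩, hxy⟩
      simp only [hxy]
      exact ⟨u.2, huC⟩
    · rintro ⟨⟨x, y⟩, ⟨⟨hx, hy⟩, hw, hC⟩, rfl⟩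
      refine ⟨⟨_, hw⟩, ⟨?_, hC⟩, rfl⟩
      exact ((exists_swap_iff (v.2.trans hw.symm)).2 ⟨x, hx, y, hy, rfl⟩).trans v.2
  rw [hsum, ← Set.ncard_image_of_injective _ Subtype.val_injective, himage,
    Set.ncard_coe_finset, Finset.card_image_of_injOn]
  refine (swap_injOn v.1).mono fun p hp => ?_
  rw [hP] at hp
  simpa using (Finset.mem_filter.1 hp).1

theorem johnsonGraph_degree {n w : ℕ} (v : {s : Finset (Fin n) // s.card = w}) :
    (((johnsonGraph n w).neighborSet v).ncard : ℤ) = w * (n - w) := by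
  have h1 : ∀ x ∈ v.1, ∀ y ∈ Finset.univ \ v.1,
      cellIndicator (n := n) (w := w) Set.univ (insert y (v.1.erase x)) = 1 := by
    intro x hx y hy
    rw [Finset.mem_sdiff] at hy
    refine if_pos ⟨?_, Set.mem_univ _⟩
    rw [Finset.card_insert_of_notMem (fun h => hy.2 (Finset.mem_of_mem_erase h)),
      Finset.card_erase_add_one hx, v.2]
  rw [← Set.inter_univ ((johnsonGraph n w).neighborSet v), ncard_neighborSet_inter,
    Finset.sum_congr rfl fun x hx => Finset.sum_congr rfl (h1 x hx)]
  have hcard : ((Finset.univ \ v.1).card : ℤ) = n - w := by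
    rw [Finset.card_sdiff_of_subset (Finset.subset_univ _),
      Nat.cast_sub (Finset.card_le_card (Finset.subset_univ _)), v.2, Finset.card_univ,
      Fintype.card_fin]
  simp only [Finset.sum_const, nsmul_eq_mul, hcard, v.2]
  ring

theorem hasMatrixEigenvalue_iff (S : Matrix (Fin 2) (Fin 2) ℤ) (μ : ℝ) :
    HasMatrixEigenvalue S μ ↔ (μ - S 0 0) * (μ - S 1 1) - S 0 1 * S 1 0 = 0 := by
  unfold HasMatrixEigenvalue
  rw [Module.End.hasEigenvalue_iff_isRoot_charpoly, Matrix.charpoly_toLin', Polynomial.IsRoot,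
    Matrix.eval_charpoly, Matrix.det_fin_two]
  simp

/-- The eigenvalue `λ_2` of a matrix with constant row sums `λ_0` determines its trace. -/
theorem hasMatrixEigenvalue_iff_of_row_sum {n w : ℕ} (hn : 1 < n) {S : Matrix (Fin 2) (Fin 2) ℤ}
    (hS : ∀ i, S i 0 + S i 1 = (w : ℤ) * (n - w)) :
    HasMatrixEigenvalue S (johnsonEigenvalue n w 2) ↔ S 0 1 + S 1 0 = 2 * n - 2 := by
  have h0 : S 0 0 = (w : ℤ) * (n - w) - S 0 1 := by linarith [hS 0]
  have h1 : S 1 1 = (w : ℤ) * (n - w) - S 1 0 := by linarith [hS 1]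
  have hn' : (1 : ℝ) < n := by exact_mod_cast hn
  rw [hasMatrixEigenvalue_iff, h0, h1, johnsonEigenvalue]
  -- The eigenvalues are `λ_0` and `λ_0 - (s₁₂ + s₂₁)`, and `λ_0 - λ_2 = 2n - 2` is nonzero.
  have : ∀ a b : ℝ, (((w : ℝ) - 2) * (n - w - 2) - 2 - (w * (n - w) - a)) *
      (((w : ℝ) - 2) * (n - w - 2) - 2 - (w * (n - w) - b)) - a * b =
        (2 * n - 2) * (2 * n - 2 - (a + b)) := fun a b => by ring
  push_cast
  rw [this, mul_eq_zero, or_iff_right (by linarith), sub_eq_zero, eq_comm]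
  exact_mod_cast Iff.rfl

theorem not_isEquitablePartition {n w : ℕ} (hn : 2 * w < n) (hw : 3 < w)
    {C : Fin 2 → Set {s : Finset (Fin n) // s.card = w}} {S : Matrix (Fin 2) (Fin 2) ℤ}
    (h : IsEquitablePartition (johnsonGraph n w) C S)
    (hS : HasMatrixEigenvalue S (johnsonEigenvalue n w 2)) : False := by
  have hcov : ∀ v, v ∈ C 0 ∨ v ∈ C 1 := fun v => by
    have : v ∈ ⋃ i, C i := h.cover ▸ Set.mem_univ v
    simpa using this
  have hdisj : Disjoint (C 0) (C 1) := h.disjoint (by decide)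
  have hrow : ∀ i, S i 0 + S i 1 = (w : ℤ) * (n - w) := by
    intro i
    obtain ⟨v, hv⟩ := h.nonempty i
    rw [← h.card_neighbors i 0 v hv, ← h.card_neighbors i 1 v hv, ← johnsonGraph_degree v,
      ← Nat.cast_add, ← Set.ncard_union_eq (hdisj.mono Set.inter_subset_right
        Set.inter_subset_right), ← Set.inter_union_distrib_left]
    congr 2
    exact Set.inter_eq_left.2 fun v _ => hcov v
  rw [hasMatrixEigenvalue_iff_of_row_sum (by omega) hrow] at hS
  obtain ⟨v₀, hv₀⟩ := h.nonempty 0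
  obtain ⟨v₁, hv₁⟩ := h.nonempty 1
  have hv₁' : v₁ ∉ C 0 := fun h' => Set.disjoint_left.1 hdisj h' hv₁
  -- The swap sum is `S 0 0` on `C 0` and `S 1 0` on `C 1`; the gap `S 0 0 - S 1 0` is `λ_2`.
  have heig : SwapEigen Finset.univ w
      (((w : ℤ) - 2) * (Fintype.card (Fin n) - w - 2) - 2) (S 1 0) (cellIndicator (C 0)) := by
    intro s _ hs
    have hnc := ncard_neighborSet_inter (C 0) ⟨s, hs⟩
    dsimp only at hnc
    rw [← hnc, Fintype.card_fin]
    rcases hcov ⟨s, hs⟩ with hv | hv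
    · rw [h.card_neighbors 0 0 _ hv, cellIndicator_of_mem hv]
      linear_combination hrow 0 - hS
    · rw [h.card_neighbors 1 0 _ hv,
        cellIndicator_of_notMem fun h' => Set.disjoint_left.1 hdisj h' hv]
      ring
  have := heig.eq_of_zero_one hw (by rwa [Fintype.card_fin]) (cellIndicator_eq_zero_or_one _)
    v₀.2 v₁.2
  rw [cellIndicator_of_mem hv₀, cellIndicator_of_notMem hv₁'] at this
  exact one_ne_zero this

end Johnson

theorem mainTheorem2 (n w : ℕ) (hn : 2 * w < n) (hw : 3 < w) :
    -- no equitable 2-partition has the eigenvalue `λ_2(n, w)`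
    (¬ ∃ (C : Fin 2 → Set {s : Finset (Fin n) // s.card = w}) (S : Matrix (Fin 2) (Fin 2) ℤ),
      IsEquitablePartition (johnsonGraph n w) C S ∧
        HasMatrixEigenvalue S (johnsonEigenvalue n w 2)) ∧
    -- no equitable 2-partition has one of the listed quotient matrices
    (∀ b : ℤ, (n : ℤ) - 1 ≤ b → b ≤ 2 * n - 1 →
      ¬ ∃ C : Fin 2 → Set {s : Finset (Fin n) // s.card = w},
        IsEquitablePartition (johnsonGraph n w) C (secondQuotientMatrix n w b)) ∧
    -- only the listed matrices come into question, up to the order of the cells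
    (∀ S : Matrix (Fin 2) (Fin 2) ℤ, (∀ i j, 0 ≤ S i j) →
      (∀ i, S i 0 + S i 1 = (w : ℤ) * (n - w)) → S 1 0 ≤ S 0 1 →
      HasMatrixEigenvalue S (johnsonEigenvalue n w 2) →
      ∃ b : ℤ, (n : ℤ) - 1 ≤ b ∧ b ≤ 2 * n - 1 ∧ S = secondQuotientMatrix n w b) := by
  refine ⟨fun ⟨C, S, hC, hS⟩ => not_isEquitablePartition hn hw hC hS, ?_, ?_⟩
  · rintro b - - ⟨C, hC⟩
    refine not_isEquitablePartition hn hw hC ((hasMatrixEigenvalue_iff_of_row_sum (by omega) ?_).2 ?_)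
    · intro i
      fin_cases i <;> simp [secondQuotientMatrix]
    · simp [secondQuotientMatrix]
  · intro S h0 hS hle hμ
    rw [hasMatrixEigenvalue_iff_of_row_sum (by omega) hS] at hμ
    have h1 := h0 1 0
    -- As the off-diagonal sum is `2n - 2`, the order of the two entries gives the lower bound and
    -- `0 ≤ S 1 0` the upper one.
    refine ⟨S 0 1, by linarith, by linarith, ?_⟩
    ext i j
    fin_cases i <;> fin_cases j <;> simp [secondQuotientMatrix] <;> linarith [hS 0, hS 1]
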